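/- Let $\mathbb{D}^*=\{z\in\mathbb{C}:0<|z|<1\}$ be the punctured unit disc, let $\lambda^*(z)=-1/(|z|\log|z|)$ for $z\in\mathbb{D}^*$, and let $\rho^*$ be the hyperbolic metric on $\mathbb{D}^*$ with density $\lambda^*$, that is, \[ \rho^*(z,w)=\inf_\gamma\int_0^1\lambda^*(\gamma(t))\,|\gamma'(t)|\,dt , \] the infimum being taken over all $C^1$ paths $\gamma\colon[0,1]\to\mathbb{D}^*$ from $z$ to $w$. For a holomorphic self-map $f$ of $\mathbb{D}^*$ let \[ \deg(f)=\frac{1}{2\pi i}\int_{|z|=1/2}\frac{f'(z)}{f(z)}\,dz \] (with the circle positively oriented), which is a nonnegative integer. \textbf{Theorem.} Suppose that $f$ is a holomorphic self-map of $\mathbb{D}^*$, that $h$ is a holomorphic self-covering map of $\mathbb{D}^*$ (a holomorphic map $\mathbb{D}^*\to\mathbb{D}^*$ that is a covering map), and that $\deg(f)=\deg(h)>0$. Suppose also that $a,z\in\mathbb{D}^*$. Then \[ \rho^*(f(z),h(z))\leq L^3\,\rho^*(f(a),h(a)),\qquad\text{where } L=8\,\lambda^*(a)\exp\rho^*(z,a).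 \] -/

import Mathlib

open scoped ComplexOrder

namespace PuncturedDisc

/-- The punctured unit disc `𝔻* = {z ∈ ℂ : |z| < 1, z ≠ 0}`. -/
def puncturedDisc : Set ℂ := Metric.ball 0 1 \ {0}

/-- The density `λ*(z) = -1 / (|z| log |z|)` of the hyperbolic metric of `𝔻*`
(normalised to have curvature `-1`). -/
noncomputable def density (z : ℂ) : ℝ := -1 / (‖z‖ * Real.log ‖z‖)

/-- `γ`, restricted to `[0, 1]`, is a `C¹` path in `𝔻*` from `z` to `w`. -/
structure IsPath (γ : ℝ → ℂ) (z w : ℂ) : Prop where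
  contDiffOn : ContDiffOn ℝ 1 γ (Set.Icc 0 1)
  mapsTo : Set.MapsTo γ (Set.Icc 0 1) puncturedDisc
  source : γ 0 = z
  target : γ 1 = w

/-- The hyperbolic length `∫ λ*(γ(t)) |γ'(t)| dt` of a path `γ` parametrised by `[0, 1]`. -/
noncomputable def hypLength (γ : ℝ → ℂ) : ℝ :=
  ∫ t in (0 : ℝ)..1, density (γ t) * ‖derivWithin γ (Set.Icc 0 1) t‖

/-- The hyperbolic metric `ρ*` of `𝔻*`: the infimum of the hyperbolic lengths of the `C¹` paths
in `𝔻*` from `z` to `w`. -/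
noncomputable def hypDist (z w : ℂ) : ℝ :=
  sInf {ℓ : ℝ | ∃ γ : ℝ → ℂ, IsPath γ z w ∧ ℓ = hypLength γ}

/-- `f` restricts to a holomorphic map from `𝔻*` to itself. -/
structure IsHolomorphicSelfMap (f : ℂ → ℂ) : Prop where
  differentiableOn : DifferentiableOn ℂ f puncturedDisc
  mapsTo : Set.MapsTo f puncturedDisc puncturedDisc

/-- `h` restricts to a holomorphic map from `𝔻*` to itself that is a covering map. -/
structure IsHolomorphicSelfCovering (h : ℂ → ℂ) : Prop extends IsHolomorphicSelfMap h where
  isCoveringMap : IsCoveringMap (mapsTo.restrict h puncturedDisc puncturedDisc)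

/-- The degree `(2πi)⁻¹ ∫_{|z| = 1/2} f'(z) / f(z) dz` of a holomorphic self-map `f` of `𝔻*`.
It is a nonnegative integer, regarded here as a complex number. -/
noncomputable def degree (f : ℂ → ℂ) : ℂ :=
  (2 * Real.pi * Complex.I)⁻¹ * ∮ z in C(0, 1 / 2), deriv f z / f z

end PuncturedDisc

/-!
# Comparing a holomorphic self-map of `𝔻*` with a self-covering of the same degree

The map `u ↦ exp (i u)` is the universal cover of `𝔻*` by the upper half-plane and a local isometry
for the hyperbolic metrics. Paths in `𝔻*` lift (`IsPath.exists_lift`), and geodesics of the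
half-plane project (`exists_isPath_hypLength_eq`), so `hypDist` is controlled on both sides by the
distance `uhpDist` of the half-plane.

Removing the singularity at `0`, a holomorphic self-map of `𝔻*` of degree `m` is
`f z = z ^ m * exp (i Γ z)` with `Γ` holomorphic on the whole unit disc and `Im Γ ≥ 0`
(`IsHolomorphicSelfMap.exists_eq_pow_mul_exp`). On the universal cover it is
`u ↦ m u + Γ (exp (i u))`. For a covering `h`, the function `Γ` is a real constant
(`IsHolomorphicSelfCovering.eq_real_const`): otherwise this lift would strictly contract the
hyperbolic metric somewhere, while lifting the universal cover through `h` provides a holomorphic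
right inverse of it, which by the Schwarz lemma does not expand the metric.

After a real translation, `h` therefore lifts to `u ↦ m u` and `f` to `u ↦ m u + G u`, where `G`
maps the half-plane to itself or is a real constant. Take lifts `u` of `z` and `v` of `a`, put
`E = exp (uhpDist u v)`, and choose the translation so that `m v + G v` and `m v` are the end points
of the lift of a given path from `f a` to `h a`. By the Schwarz–Pick lemma, the quantities `|G|`,
`Im G` and the imaginary part itself each change by a factor of at most `E` between `u` and `v`. As
the distance `d` from `m u + G u` to `m u` satisfies
`sinh (d / 2) = |G u| / (2 √((m Im u + Im (G u)) (m Im u)))`,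
the value of `sinh (d / 2)` at `u` is at most `E ^ 2` times that at `v`, and hence so is `d`
(`uhpDist_displacement_le`). Since `u` and `v` can be chosen with `E` as close as desired to
`exp (ρ* (z, a))`, and `λ* ≥ 1` on `𝔻*`, the bound by `E ^ 2` leaves room to spare below `L ^ 3`.
-/

namespace PuncturedDisc

open Set Filter Topology Metric

/-! ### The hyperbolic distance of the upper half-plane -/

/-- The hyperbolic distance of the upper half-plane (curvature `-1`), written as a total function
on `ℂ × ℂ`; it is meaningful when both points have positive imaginary part. -/
noncomputable def uhpDist (z w : ℂ) : ℝ :=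
  2 * Real.arsinh (‖z - w‖ / (2 * √(z.im * w.im)))

lemma uhpDist_eq_dist {z w : ℂ} (hz : 0 < z.im) (hw : 0 < w.im) :
    uhpDist z w = dist (⟨z, hz⟩ : UpperHalfPlane) ⟨w, hw⟩ := by
  rw [UpperHalfPlane.dist_eq, dist_eq_norm]; rfl

lemma uhpDist_nonneg (z w : ℂ) : 0 ≤ uhpDist z w := by
  have : 0 ≤ Real.arsinh (‖z - w‖ / (2 * √(z.im * w.im))) :=
    Real.arsinh_nonneg_iff.2 (by positivity)
  unfold uhpDist; linarith

lemma uhpDist_self (z : ℂ) : uhpDist z z = 0 := by simp [uhpDist]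

lemma sinh_half_uhpDist (z w : ℂ) :
    Real.sinh (uhpDist z w / 2) = ‖z - w‖ / (2 * √(z.im * w.im)) := by
  rw [uhpDist, mul_div_cancel_left₀ _ two_ne_zero, Real.sinh_arsinh]

lemma uhpDist_comm (z w : ℂ) : uhpDist z w = uhpDist w z := by
  rw [uhpDist, uhpDist, norm_sub_rev, mul_comm z.im]

lemma uhpDist_triangle {z w v : ℂ} (hz : 0 < z.im) (hw : 0 < w.im) (hv : 0 < v.im) :
    uhpDist z v ≤ uhpDist z w + uhpDist w v := by
  rw [uhpDist_eq_dist hz hv, uhpDist_eq_dist hz hw, uhpDist_eq_dist hw hv]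
  exact dist_triangle _ _ _

lemma uhpDist_le_norm_div_sqrt {z w : ℂ} (hz : 0 < z.im) (hw : 0 < w.im) :
    uhpDist z w ≤ ‖z - w‖ / √(z.im * w.im) := by
  rw [uhpDist_eq_dist hz hw, ← dist_eq_norm]
  exact UpperHalfPlane.dist_le_dist_coe_div_sqrt _ _

lemma im_le_im_mul_exp_uhpDist {z w : ℂ} (hz : 0 < z.im) (hw : 0 < w.im) :
    z.im ≤ w.im * Real.exp (uhpDist z w) := by
  rw [uhpDist_eq_dist hz hw]
  exact UpperHalfPlane.im_le_im_mul_exp_dist ⟨z, hz⟩ ⟨w, hw⟩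

lemma neg_inv_im (z : ℂ) : (-z⁻¹).im = z.im / ‖z‖ ^ 2 := by
  rw [Complex.neg_im, Complex.inv_im, Complex.sq_norm, neg_div, neg_neg]

lemma ne_zero_of_im_pos {z : ℂ} (hz : 0 < z.im) : z ≠ 0 := by
  rintro rfl; simp at hz

/-- The inversion `z ↦ -1 / z` is an isometry of the upper half-plane. -/
lemma uhpDist_neg_inv {z w : ℂ} (hz : 0 < z.im) (hw : 0 < w.im) :
    uhpDist (-z⁻¹) (-w⁻¹) = uhpDist z w := by
  have h1 : z ≠ 0 := ne_zero_of_im_pos hz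
  have h2 : w ≠ 0 := ne_zero_of_im_pos hw
  have h3 : -z⁻¹ - -w⁻¹ = (z - w) / (z * w) := by field_simp; ring
  have h4 : z.im / ‖z‖ ^ 2 * (w.im / ‖w‖ ^ 2) = (z.im * w.im) / (‖z‖ * ‖w‖) ^ 2 := by
    field_simp
  have h5 : 0 < ‖z‖ * ‖w‖ := by positivity
  rw [uhpDist, uhpDist, neg_inv_im, neg_inv_im, h3, h4, Real.sqrt_div (by positivity),
    Real.sqrt_sq h5.le, norm_div, norm_mul]
  congr 2
  have : 0 < √(z.im * w.im) := by positivity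
  field_simp

/-- Since `z ↦ log |z|` is `1`-Lipschitz for the hyperbolic metric of the upper half-plane, moduli
grow at most exponentially with the distance. -/
lemma norm_le_norm_mul_exp_uhpDist {z w : ℂ} (hz : 0 < z.im) (hw : 0 < w.im) :
    ‖z‖ ≤ ‖w‖ * Real.exp (uhpDist z w) := by
  have hz0 : 0 < ‖z‖ := norm_pos_iff.2 (ne_zero_of_im_pos hz)
  have hw0 : 0 < ‖w‖ := norm_pos_iff.2 (ne_zero_of_im_pos hw)
  have h1 := im_le_im_mul_exp_uhpDist hz hw
  have h2 : (-w⁻¹).im ≤ (-z⁻¹).im * Real.exp (uhpDist (-w⁻¹) (-z⁻¹)) :=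
    im_le_im_mul_exp_uhpDist (by rw [neg_inv_im]; positivity) (by rw [neg_inv_im]; positivity)
  rw [uhpDist_neg_inv hw hz, neg_inv_im, neg_inv_im, uhpDist_comm w z] at h2
  set E := Real.exp (uhpDist z w) with hE
  have hE0 : 0 < E := Real.exp_pos _
  have h3 : w.im * ‖z‖ ^ 2 ≤ z.im * E * ‖w‖ ^ 2 := by
    rw [div_mul_eq_mul_div, div_le_div_iff₀ (by positivity) (by positivity)] at h2
    exact h2
  have h4 : w.im * ‖z‖ ^ 2 ≤ w.im * (‖w‖ * E) ^ 2 := by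
    calc w.im * ‖z‖ ^ 2 ≤ z.im * E * ‖w‖ ^ 2 := h3
      _ ≤ (w.im * E) * E * ‖w‖ ^ 2 := by gcongr
      _ = _ := by ring
  exact (sq_le_sq₀ hz0.le (by positivity)).1 (le_of_mul_le_mul_left h4 hw)

lemma norm_sub_conj_sq (z w : ℂ) :
    ‖z - (starRingEnd ℂ) w‖ ^ 2 = ‖z - w‖ ^ 2 + 4 * (z.im * w.im) := by
  rw [Complex.sq_norm, Complex.sq_norm, Complex.normSq_apply, Complex.normSq_apply]
  simp
  ring

lemma norm_sub_lt_norm_sub_conj {z w : ℂ} (hz : 0 < z.im) (hw : 0 < w.im) :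
    ‖z - w‖ < ‖z - (starRingEnd ℂ) w‖ := by
  have := norm_sub_conj_sq z w
  have h2 : 0 < z.im * w.im := by positivity
  exact lt_of_pow_lt_pow_left₀ 2 (norm_nonneg _) (by linarith)

lemma sub_conj_ne_zero {z w : ℂ} (hz : 0 < z.im) (hw : 0 < w.im) :
    z - (starRingEnd ℂ) w ≠ 0 :=
  norm_pos_iff.1 ((norm_nonneg _).trans_lt (norm_sub_lt_norm_sub_conj hz hw))

/-- The hyperbolic distance is an increasing function of `|z - w| / |z - conj w|`. -/
lemma uhpDist_le_uhpDist_of_ratio {z w u v : ℂ} (hz : 0 < z.im) (hw : 0 < w.im) (hu : 0 < u.im)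
    (hv : 0 < v.im)
    (h : ‖z - w‖ / ‖z - (starRingEnd ℂ) w‖ ≤ ‖u - v‖ / ‖u - (starRingEnd ℂ) v‖) :
    uhpDist z w ≤ uhpDist u v := by
  have h1 : 0 < z.im * w.im := by positivity
  have h2 : 0 < u.im * v.im := by positivity
  have h3 : 0 < ‖z - (starRingEnd ℂ) w‖ := norm_pos_iff.2 (sub_conj_ne_zero hz hw)
  have h4 : 0 < ‖u - (starRingEnd ℂ) v‖ := norm_pos_iff.2 (sub_conj_ne_zero hu hv)
  have h5 : (‖z - w‖ / ‖z - (starRingEnd ℂ) w‖) ^ 2 ≤ (‖u - v‖ / ‖u - (starRingEnd ℂ) v‖) ^ 2 := by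
    gcongr
  rw [div_pow, div_pow, div_le_div_iff₀ (by positivity) (by positivity), norm_sub_conj_sq,
    norm_sub_conj_sq] at h5
  have h6 : ‖z - w‖ ^ 2 * (u.im * v.im) ≤ ‖u - v‖ ^ 2 * (z.im * w.im) := by linarith
  have h7 : ‖z - w‖ * √(u.im * v.im) ≤ ‖u - v‖ * √(z.im * w.im) := by
    refine (sq_le_sq₀ (by positivity) (by positivity)).1 ?_
    rwa [mul_pow, mul_pow, Real.sq_sqrt h1.le, Real.sq_sqrt h2.le]
  unfold uhpDist
  have h8 : ‖z - w‖ / (2 * √(z.im * w.im)) ≤ ‖u - v‖ / (2 * √(u.im * v.im)) := by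
    have := Real.sqrt_pos.2 h1
    have := Real.sqrt_pos.2 h2
    rw [div_le_div_iff₀ (by positivity) (by positivity)]
    linarith
  have := Real.arsinh_le_arsinh.2 h8
  linarith

/-! ### The Schwarz–Pick lemma -/

/-- **Schwarz lemma** for maps of a disc into the upper half-plane. -/
lemma norm_cayley_le_of_mapsTo_upperHalfPlane {F : ℂ → ℂ} {c : ℂ} {R : ℝ}
    (hF : DifferentiableOn ℂ F (Metric.ball c R)) (hpos : ∀ x ∈ Metric.ball c R, 0 < (F x).im)
    {x : ℂ} (hx : x ∈ Metric.ball c R) :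
    ‖F x - F c‖ / ‖F x - (starRingEnd ℂ) (F c)‖ ≤ ‖x - c‖ / R := by
  have hR : 0 < R := Metric.nonempty_ball.1 ⟨x, hx⟩
  have hc := hpos c (Metric.mem_ball_self hR)
  have h := Complex.dist_le_div_mul_dist_of_mapsTo_ball (R₂ := 1)
    (f := fun x => (F x - F c) / (F x - (starRingEnd ℂ) (F c)))
    ((hF.sub_const _).div (hF.sub_const _) fun y hy => sub_conj_ne_zero (hpos y hy) hc)
    (fun y hy => by
      have := norm_sub_lt_norm_sub_conj (hpos y hy) hc
      simp only [sub_self, zero_div, Metric.mem_closedBall, dist_zero_right, norm_div]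
      exact div_le_one_of_le₀ this.le (norm_nonneg _)) hx
  simp only [sub_self, zero_div, sub_zero, norm_div, dist_eq_norm] at h
  rwa [one_div_mul_eq_div] at h

lemma norm_deriv_le_of_mapsTo_upperHalfPlane {F : ℂ → ℂ} {c : ℂ} {R : ℝ} (hR : 0 < R)
    (hF : DifferentiableOn ℂ F (Metric.ball c R)) (hpos : ∀ x ∈ Metric.ball c R, 0 < (F x).im) :
    ‖deriv F c‖ ≤ 2 * (F c).im / R := by
  have hc := hpos c (Metric.mem_ball_self hR)
  have h := Complex.norm_deriv_le_div_of_mapsTo_ball (R₂ := 1)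
    (f := fun x => (F x - F c) / (F x - (starRingEnd ℂ) (F c)))
    ((hF.sub_const _).div (hF.sub_const _) fun y hy => sub_conj_ne_zero (hpos y hy) hc)
    (fun y hy => by
      have := norm_sub_lt_norm_sub_conj (hpos y hy) hc
      simp only [sub_self, zero_div, Metric.mem_closedBall, dist_zero_right, norm_div]
      exact div_le_one_of_le₀ this.le (norm_nonneg _)) hR
  have hd : HasDerivAt F (deriv F c) c :=
    (hF.differentiableAt (Metric.ball_mem_nhds _ hR)).hasDerivAt
  have h2 : ‖F c - (starRingEnd ℂ) (F c)‖ = 2 * (F c).im := by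
    rw [Complex.sub_conj, norm_mul, Complex.norm_I, Complex.norm_real, Real.norm_of_nonneg]
    · ring
    · linarith
  have h3 := ((hd.sub_const (F c)).div (hd.sub_const ((starRingEnd ℂ) (F c)))
    (sub_conj_ne_zero hc hc)).deriv
  have h4 : deriv (fun x => (F x - F c) / (F x - (starRingEnd ℂ) (F c))) c
      = deriv F c / (F c - (starRingEnd ℂ) (F c)) := by
    refine h3.trans ?_
    have := sub_conj_ne_zero hc hc
    field_simp
    ring
  rw [h4, norm_div, h2, div_le_div_iff₀ (by linarith) hR] at h
  rw [le_div_iff₀ hR]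
  linarith

/-- The Möbius map of the unit disc onto the upper half-plane taking `0` to `v`. -/
noncomputable def discToUpperHalfPlane (v x : ℂ) : ℂ := (v - (starRingEnd ℂ) v * x) / (1 - x)

lemma one_sub_ne_zero_of_mem_ball {x : ℂ} (hx : x ∈ Metric.ball (0 : ℂ) 1) : 1 - x ≠ 0 := by
  intro h
  rw [sub_eq_zero] at h
  subst h
  simp at hx

@[simp] lemma discToUpperHalfPlane_zero (v : ℂ) : discToUpperHalfPlane v 0 = v := by
  simp [discToUpperHalfPlane]

lemma discToUpperHalfPlane_im_pos {v x : ℂ} (hv : 0 < v.im) (hx : x ∈ Metric.ball (0 : ℂ) 1) :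
    0 < (discToUpperHalfPlane v x).im := by
  have h0 := one_sub_ne_zero_of_mem_ball hx
  have h1 : (discToUpperHalfPlane v x).im =
      v.im * (1 - Complex.normSq x) / Complex.normSq (1 - x) := by
    rw [discToUpperHalfPlane, Complex.div_im]
    simp [Complex.normSq_apply]
    ring
  have h2 : Complex.normSq x < 1 := by
    rw [Complex.normSq_eq_norm_sq]
    rw [mem_ball_zero_iff] at hx
    exact pow_lt_one₀ (norm_nonneg _) hx two_ne_zero
  have h3 : 0 < Complex.normSq (1 - x) := Complex.normSq_pos.2 h0
  rw [h1]
  have : 0 < 1 - Complex.normSq x := by linarith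
  positivity

lemma hasDerivAt_discToUpperHalfPlane (v : ℂ) {x : ℂ} (hx : x ∈ Metric.ball (0 : ℂ) 1) :
    HasDerivAt (discToUpperHalfPlane v) ((v - (starRingEnd ℂ) v) / (1 - x) ^ 2) x := by
  have h0 := one_sub_ne_zero_of_mem_ball hx
  have h1 : HasDerivAt (fun x : ℂ => v - (starRingEnd ℂ) v * x) (-((starRingEnd ℂ) v * 1)) x :=
    ((hasDerivAt_id x).const_mul _).const_sub _
  have h2 : HasDerivAt (fun x : ℂ => 1 - x) (-1) x := (hasDerivAt_id x).const_sub _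
  refine (h1.div h2 h0).congr_deriv ?_
  congr 1
  ring

/-- **Schwarz–Pick lemma** for the upper half-plane. -/
lemma uhpDist_map_le {F : ℂ → ℂ} (hF : DifferentiableOn ℂ F {u | 0 < u.im})
    (hpos : ∀ u : ℂ, 0 < u.im → 0 < (F u).im) {u v : ℂ} (hu : 0 < u.im) (hv : 0 < v.im) :
    uhpDist (F u) (F v) ≤ uhpDist u v := by
  have hne := sub_conj_ne_zero hu hv
  have hx : (u - v) / (u - (starRingEnd ℂ) v) ∈ Metric.ball (0 : ℂ) 1 := by
    rw [mem_ball_zero_iff, norm_div, div_lt_one (norm_pos_iff.2 hne)]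
    exact norm_sub_lt_norm_sub_conj hu hv
  have hφ : discToUpperHalfPlane v ((u - v) / (u - (starRingEnd ℂ) v)) = u := by
    have hv2 := sub_conj_ne_zero hv hv
    have h1 : 1 - (u - v) / (u - (starRingEnd ℂ) v)
        = (v - (starRingEnd ℂ) v) / (u - (starRingEnd ℂ) v) := by field_simp; ring
    rw [discToUpperHalfPlane, h1]
    field_simp
    ring
  have h := norm_cayley_le_of_mapsTo_upperHalfPlane (F := F ∘ discToUpperHalfPlane v) (c := 0)
    (R := 1) (hF.comp
      (fun x hx => (hasDerivAt_discToUpperHalfPlane v hx).differentiableAt.differentiableWithinAt)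
      fun x hx => discToUpperHalfPlane_im_pos hv hx)
    (fun x hx => hpos _ (discToUpperHalfPlane_im_pos hv hx)) hx
  simp only [Function.comp_apply, hφ, discToUpperHalfPlane_zero, sub_zero, div_one, norm_div] at h
  exact uhpDist_le_uhpDist_of_ratio (hpos u hu) (hpos v hv) hu hv h

/-! ### The universal cover of the punctured disc -/

lemma norm_exp_I_mul (u : ℂ) : ‖Complex.exp (Complex.I * u)‖ = Real.exp (-u.im) := by
  rw [Complex.norm_exp]; simp

lemma exp_I_mul_mem_puncturedDisc {u : ℂ} (hu : 0 < u.im) :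
    Complex.exp (Complex.I * u) ∈ puncturedDisc := by
  refine ⟨?_, Complex.exp_ne_zero _⟩
  rw [mem_ball_zero_iff, norm_exp_I_mul, Real.exp_lt_one_iff]
  linarith

lemma im_pos_of_exp_I_mul_mem {u : ℂ} (hu : Complex.exp (Complex.I * u) ∈ puncturedDisc) :
    0 < u.im := by
  have := mem_ball_zero_iff.1 hu.1
  rw [norm_exp_I_mul, Real.exp_lt_one_iff] at this
  linarith

lemma exists_exp_I_mul_eq {z : ℂ} (hz : z ∈ puncturedDisc) :
    ∃ u : ℂ, 0 < u.im ∧ Complex.exp (Complex.I * u) = z := by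
  have h : Complex.exp (Complex.I * (-Complex.I * Complex.log z)) = z := by
    rw [← mul_assoc, mul_neg, Complex.I_mul_I, neg_neg, one_mul, Complex.exp_log hz.2]
  exact ⟨_, im_pos_of_exp_I_mul_mem (by rwa [h]), h⟩

/-- The covering `u ↦ exp (i u)` is a local isometry: the pulled back density is `1 / Im u`. -/
lemma density_exp_I_mul (u : ℂ) :
    density (Complex.exp (Complex.I * u)) * Real.exp (-u.im) = 1 / u.im := by
  rw [density, norm_exp_I_mul, Real.log_exp]
  have := Real.exp_pos (-u.im)
  by_cases h : u.im = 0
  · simp [h]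
  · field_simp

lemma density_nonneg {z : ℂ} (hz : z ∈ puncturedDisc) : 0 ≤ density z := by
  have h := Real.log_nonpos (norm_nonneg z) (mem_ball_zero_iff.1 hz.1).le
  have h2 : ‖z‖ * Real.log ‖z‖ ≤ 0 := mul_nonpos_of_nonneg_of_nonpos (norm_nonneg z) h
  exact div_nonneg_of_nonpos (by norm_num) h2

lemma one_le_density {z : ℂ} (hz : z ∈ puncturedDisc) : 1 ≤ density z := by
  have h0 : 0 < ‖z‖ := norm_pos_iff.2 hz.2
  have h1 : ‖z‖ < 1 := mem_ball_zero_iff.1 hz.1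
  have h2 := Real.log_neg h0 h1
  have h3 := Real.one_sub_inv_le_log_of_pos h0
  have h4 : 0 < ‖z‖ * -Real.log ‖z‖ := mul_pos h0 (by linarith)
  have h5 : density z = 1 / (‖z‖ * -Real.log ‖z‖) := by
    rw [density, mul_neg, div_neg, neg_div]
  rw [h5, le_div_iff₀ h4]
  have h6 : ‖z‖ * (1 - ‖z‖⁻¹) ≤ ‖z‖ * Real.log ‖z‖ := by gcongr
  rw [mul_sub, mul_inv_cancel₀ h0.ne'] at h6
  linarith

/-! ### Lifting paths -/

lemma hypLength_nonneg {γ : ℝ → ℂ} {z w : ℂ} (hγ : IsPath γ z w) : 0 ≤ hypLength γ :=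
  intervalIntegral.integral_nonneg zero_le_one fun _ ht =>
    mul_nonneg (density_nonneg (hγ.mapsTo ht)) (norm_nonneg _)

lemma hypDist_le_hypLength {γ : ℝ → ℂ} {z w : ℂ} (hγ : IsPath γ z w) :
    hypDist z w ≤ hypLength γ := by
  refine csInf_le ⟨0, ?_⟩ ⟨γ, hγ, rfl⟩
  rintro _ ⟨σ, hσ, rfl⟩
  exact hypLength_nonneg hσ

lemma exists_continuous_eqOn_Icc {E : Type*} [TopologicalSpace E] {g : ℝ → E}
    (hg : ContinuousOn g (Icc 0 1)) : ∃ G : ℝ → E, Continuous G ∧ EqOn G g (Icc 0 1) := by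
  refine ⟨fun t => g (max 0 (min 1 t)), hg.comp_continuous (by fun_prop) fun t => ?_,
    fun t ht => ?_⟩
  · exact ⟨le_max_left _ _, max_le zero_le_one (min_le_left _ _)⟩
  · simp only [min_eq_right ht.2, max_eq_right ht.1]

/-- The hyperbolic distance of the end points of a `C¹` curve in the upper half-plane is at most
the hyperbolic length of the curve. -/
lemma uhpDist_le_integral {ζ ζ' : ℝ → ℂ} (hζ : ∀ t, HasDerivAt ζ (ζ' t) t) (hc : Continuous ζ')
    (hpos : ∀ t ∈ Icc (0 : ℝ) 1, 0 < (ζ t).im) :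
    uhpDist (ζ 0) (ζ 1) ≤ ∫ t in (0 : ℝ)..1, ‖ζ' t‖ / (ζ t).im := by
  have hζc : Continuous ζ := continuous_iff_continuousAt.2 fun t => (hζ t).continuousAt
  have him : Continuous fun t => (ζ t).im := Complex.continuous_im.comp hζc
  obtain ⟨G, hG, hGe⟩ := exists_continuous_eqOn_Icc
    (hc.norm.continuousOn.div him.continuousOn fun t ht => (hpos t ht).ne')
  have h0 : (0 : ℝ) ∈ Icc (0 : ℝ) 1 := ⟨le_rfl, zero_le_one⟩
  have h1 : (1 : ℝ) ∈ Icc (0 : ℝ) 1 := ⟨zero_le_one, le_rfl⟩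
  have hB : ∀ t, HasDerivAt (fun t => ∫ s in (0 : ℝ)..t, G s) (G t) t := fun t =>
    (hG.integral_hasStrictDerivAt 0 t).hasDerivAt
  have hint : ∫ t in (0 : ℝ)..1, ‖ζ' t‖ / (ζ t).im = ∫ s in (0 : ℝ)..1, G s := by
    refine intervalIntegral.integral_congr fun t ht => ?_
    rw [uIcc_of_le zero_le_one] at ht
    exact (hGe ht).symm
  rw [hint]
  refine image_le_of_liminf_slope_right_le_deriv_boundary (f := fun t => uhpDist (ζ 0) (ζ t))
    (B := fun t => ∫ s in (0 : ℝ)..t, G s) (B' := G) ?_ ?_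
    (fun t _ => (hB t).continuousAt.continuousWithinAt) (fun t _ => (hB t).hasDerivWithinAt) ?_ h1
  · unfold uhpDist
    refine ContinuousOn.mul continuousOn_const (Real.continuous_arsinh.comp_continuousOn ?_)
    refine ContinuousOn.div (by fun_prop) (by fun_prop) fun t ht => ?_
    have := hpos t ht
    have := hpos 0 h0
    positivity
  · simp [uhpDist_self]
  · intro x hx r hr
    have hxI : x ∈ Icc (0 : ℝ) 1 := ⟨hx.1, hx.2.le⟩
    have hxp := hpos x hxI
    have hlim : Tendsto (fun t => ‖slope ζ x t‖ / √((ζ x).im * (ζ t).im)) (𝓝[>] x)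
        (𝓝 (G x)) := by
      have e : G x = ‖ζ' x‖ / √((ζ x).im * (ζ x).im) := by
        rw [Real.sqrt_mul_self hxp.le]; exact hGe hxI
      rw [e]
      refine Tendsto.div ?_ ?_ (by positivity)
      · exact ((hasDerivAt_iff_tendsto_slope.1 (hζ x)).mono_left
          (nhdsWithin_mono _ fun y hy => (ne_of_gt hy))).norm
      · exact ((by fun_prop : Continuous fun t => √((ζ x).im * (ζ t).im)).tendsto x).mono_left
          nhdsWithin_le_nhds
    have hev := hlim.eventually_lt_const hr
    have hI : ∀ᶠ t in 𝓝[>] x, t ∈ Ioc x 1 := Ioc_mem_nhdsGT hx.2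
    refine (hev.and hI).frequently.mono fun t ⟨ht, htI⟩ => lt_of_le_of_lt ?_ ht
    have htp := hpos t ⟨hx.1.trans htI.1.le, htI.2⟩
    have hd : uhpDist (ζ 0) (ζ t) - uhpDist (ζ 0) (ζ x) ≤
        ‖ζ t - ζ x‖ / √((ζ x).im * (ζ t).im) := by
      have a1 := uhpDist_triangle (hpos 0 h0) hxp htp
      have a2 := uhpDist_le_norm_div_sqrt hxp htp
      rw [norm_sub_rev] at a2
      linarith
    have hpos' : 0 < t - x := sub_pos.2 htI.1
    rw [slope_def_field, slope_def_module, norm_smul, norm_inv, Real.norm_of_nonneg hpos'.le,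
      inv_mul_eq_div, div_right_comm]
    exact div_le_div_of_nonneg_right hd hpos'.le

/-- A path in `𝔻*` lifts through `u ↦ exp (i u)`, so the end points of the lift are no further
apart in the upper half-plane than the length of the path. -/
lemma IsPath.exists_lift {γ : ℝ → ℂ} {z w : ℂ} (hγ : IsPath γ z w) {u : ℂ}
    (hu : Complex.exp (Complex.I * u) = z) :
    ∃ v : ℂ, 0 < v.im ∧ Complex.exp (Complex.I * v) = w ∧ uhpDist u v ≤ hypLength γ := by
  have hne : ∀ t ∈ Icc (0 : ℝ) 1, γ t ≠ 0 := fun t ht => (hγ.mapsTo ht).2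
  have hUD : UniqueDiffOn ℝ (Icc (0 : ℝ) 1) := uniqueDiffOn_Icc zero_lt_one
  have hdc : ContinuousOn (derivWithin γ (Icc 0 1)) (Icc 0 1) :=
    hγ.contDiffOn.continuousOn_derivWithin hUD le_rfl
  have hdw : ∀ t ∈ Icc (0 : ℝ) 1, HasDerivWithinAt γ (derivWithin γ (Icc 0 1) t) (Icc 0 1) t :=
    fun t ht => (hγ.contDiffOn.differentiableOn one_ne_zero t ht).hasDerivWithinAt
  obtain ⟨G, hG, hGe⟩ := exists_continuous_eqOn_Icc
    (hdc.div (continuousOn_const.mul hγ.contDiffOn.continuousOn)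
      fun t ht => mul_ne_zero Complex.I_ne_zero (hne t ht))
  set ζ : ℝ → ℂ := fun t => u + ∫ s in (0 : ℝ)..t, G s with hζdef
  have hζ : ∀ t, HasDerivAt ζ (G t) t := fun t =>
    (hG.integral_hasStrictDerivAt 0 t).hasDerivAt.const_add u
  have hζ0 : ζ 0 = u := by simp [hζdef]
  have hGγ : ∀ t ∈ Icc (0 : ℝ) 1, derivWithin γ (Icc 0 1) t = G t * (Complex.I * γ t) := by
    intro t ht
    rw [hGe ht]
    exact (div_mul_cancel₀ _ (mul_ne_zero Complex.I_ne_zero (hne t ht))).symm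
  -- `γ(t) exp (-i ζ(t))` has derivative zero
  have hder : ∀ t ∈ Icc (0 : ℝ) 1, HasDerivWithinAt
      (fun t => γ t * Complex.exp (-(Complex.I * ζ t))) 0 (Icc 0 1) t := by
    intro t ht
    have h1 := (hdw t ht).mul ((((hζ t).hasDerivWithinAt (s := Icc 0 1)).const_mul
      Complex.I).neg.cexp)
    refine h1.congr_deriv ?_
    rw [hGγ t ht]
    ring
  have hconst : ∀ t ∈ Icc (0 : ℝ) 1, γ t * Complex.exp (-(Complex.I * ζ t)) =
      γ 0 * Complex.exp (-(Complex.I * ζ 0)) :=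
    constant_of_derivWithin_zero (fun t ht => (hder t ht).differentiableWithinAt)
      fun t ht => (hder t ⟨ht.1, ht.2.le⟩).derivWithin (hUD t ⟨ht.1, ht.2.le⟩)
  have hexp : ∀ t ∈ Icc (0 : ℝ) 1, Complex.exp (Complex.I * ζ t) = γ t := by
    intro t ht
    have h1 := hconst t ht
    rw [hζ0, hγ.source, ← hu, ← Complex.exp_add, add_neg_cancel, Complex.exp_zero,
      Complex.exp_neg, ← div_eq_mul_inv, div_eq_one_iff_eq (Complex.exp_ne_zero _)] at h1
    exact h1.symm
  have hpos : ∀ t ∈ Icc (0 : ℝ) 1, 0 < (ζ t).im := fun t ht =>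
    im_pos_of_exp_I_mul_mem (by rw [hexp t ht]; exact hγ.mapsTo ht)
  have h1 : (1 : ℝ) ∈ Icc (0 : ℝ) 1 := ⟨zero_le_one, le_rfl⟩
  refine ⟨ζ 1, hpos 1 h1, by rw [hexp 1 h1, hγ.target], ?_⟩
  have hlen : hypLength γ = ∫ t in (0 : ℝ)..1, ‖G t‖ / (ζ t).im := by
    refine intervalIntegral.integral_congr fun t ht => ?_
    rw [uIcc_of_le zero_le_one] at ht
    have e := density_exp_I_mul (ζ t)
    rw [hGγ t ht, norm_mul, norm_mul, Complex.norm_I, one_mul, ← hexp t ht, norm_exp_I_mul,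
      mul_left_comm, e, mul_one_div]
  rw [hlen, ← hζ0]
  exact uhpDist_le_integral hζ hG hpos

/-! ### Geodesics -/

/-- The image in `𝔻*` of a curve of constant hyperbolic speed `|ℓ|` in the upper half-plane. -/
lemma exists_isPath_of_constant_speed {X Y X' Y' : ℝ → ℝ} {ℓ : ℝ}
    (hX : ∀ t, HasDerivAt X (X' t) t) (hY : ∀ t, HasDerivAt Y (Y' t) t)
    (hX' : Continuous X') (hY' : Continuous Y') (hpos : ∀ t, 0 < Y t)
    (hspeed : ∀ t, X' t ^ 2 + Y' t ^ 2 = (ℓ * Y t) ^ 2) :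
    ∃ γ, IsPath γ (Complex.exp (Complex.I * (X 0 + Y 0 * Complex.I)))
      (Complex.exp (Complex.I * (X 1 + Y 1 * Complex.I))) ∧ hypLength γ = |ℓ| := by
  set c : ℝ → ℂ := fun t => X t + Y t * Complex.I with hc
  have him : ∀ t, (c t).im = Y t := fun t => by simp [hc]
  have hcd : ∀ t, HasDerivAt c (X' t + Y' t * Complex.I) t := fun t =>
    (hX t).ofReal_comp.add ((hY t).ofReal_comp.mul_const _)
  have hγd : ∀ t, HasDerivAt (fun t => Complex.exp (Complex.I * c t))
      (Complex.exp (Complex.I * c t) * (Complex.I * (X' t + Y' t * Complex.I))) t := fun t =>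
    ((hcd t).const_mul Complex.I).cexp
  have hcc : Continuous c := continuous_iff_continuousAt.2 fun t => (hcd t).continuousAt
  refine ⟨fun t => Complex.exp (Complex.I * c t), ⟨?_, ?_, rfl, rfl⟩, ?_⟩
  · refine (contDiff_one_iff_deriv.2 ⟨fun t => (hγd t).differentiableAt, ?_⟩).contDiffOn
    rw [show deriv (fun t => Complex.exp (Complex.I * c t)) = fun t => _ from
      funext fun t => (hγd t).deriv]
    fun_prop
  · intro t _
    exact exp_I_mul_mem_puncturedDisc (by rw [him]; exact hpos t)
  · have : ∀ t ∈ uIcc (0 : ℝ) 1, density (Complex.exp (Complex.I * c t)) *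
        ‖derivWithin (fun t => Complex.exp (Complex.I * c t)) (Icc 0 1) t‖ = |ℓ| := by
      intro t ht
      rw [uIcc_of_le zero_le_one] at ht
      rw [(hγd t).hasDerivWithinAt.derivWithin (uniqueDiffOn_Icc zero_lt_one t ht), norm_mul,
        norm_exp_I_mul, ← mul_assoc, density_exp_I_mul, him, norm_mul, Complex.norm_I, one_mul,
        Complex.norm_add_mul_I, hspeed, Real.sqrt_sq_eq_abs, abs_mul, abs_of_pos (hpos t)]
      have := hpos t
      field_simp
    rw [hypLength, intervalIntegral.integral_congr this]
    simp

lemma abs_eq_uhpDist_of_cosh {u v : ℂ} {d : ℝ} (hu : 0 < u.im) (hv : 0 < v.im)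
    (h : Real.cosh d * (2 * u.im * v.im) =
      2 * u.im * v.im + ((u.re - v.re) ^ 2 + (u.im - v.im) ^ 2)) :
    |d| = uhpDist u v := by
  have h1 : Real.cosh (uhpDist u v) = 1 + ‖u - v‖ ^ 2 / (2 * u.im * v.im) := by
    rw [uhpDist_eq_dist hu hv, UpperHalfPlane.cosh_dist, dist_eq_norm]
    rfl
  have h2 : ‖u - v‖ ^ 2 = (u.re - v.re) ^ 2 + (u.im - v.im) ^ 2 := by
    rw [Complex.sq_norm, Complex.normSq_apply]; simp; ring
  have h3 : Real.cosh d = Real.cosh (uhpDist u v) := by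
    rw [h1, h2]; field_simp; linarith
  have h4 := le_antisymm (Real.cosh_le_cosh.1 h3.le) (Real.cosh_le_cosh.1 h3.ge)
  rw [h4, abs_of_nonneg (uhpDist_nonneg u v)]

/-- The image in `𝔻*` of the geodesic of the upper half-plane from `u` to `v`. A geodesic off a
vertical line has the unit speed parametrisation `x₀ + r tanh s + i r / cosh s`. -/
lemma exists_isPath_hypLength_eq {u v : ℂ} (hu : 0 < u.im) (hv : 0 < v.im) :
    ∃ γ, IsPath γ (Complex.exp (Complex.I * u)) (Complex.exp (Complex.I * v)) ∧
      hypLength γ = uhpDist u v := by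
  by_cases hre : u.re = v.re
  · set a := Real.log u.im with ha
    set b := Real.log v.im with hb
    have hs : ∀ t : ℝ, HasDerivAt (fun t : ℝ => a + t * (b - a)) (b - a) t := fun t => by
      simpa using ((hasDerivAt_id t).mul_const (b - a)).const_add a
    obtain ⟨γ, hγ, hℓ⟩ := exists_isPath_of_constant_speed (X := fun _ => u.re)
      (Y := fun t => Real.exp (a + t * (b - a))) (X' := fun _ => 0)
      (Y' := fun t => Real.exp (a + t * (b - a)) * (b - a)) (ℓ := b - a)
      (fun t => hasDerivAt_const t _) (fun t => (hs t).exp) continuous_const (by fun_prop)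
      (fun t => Real.exp_pos _) (fun t => by ring)
    have e0 : Real.exp a = u.im := Real.exp_log hu
    have e1 : Real.exp b = v.im := Real.exp_log hv
    have hab : a + (b - a) = b := by ring
    simp only [zero_mul, add_zero, one_mul, hab, e0, e1] at hγ
    rw [Complex.re_add_im, hre, Complex.re_add_im] at hγ
    refine ⟨γ, hγ, hℓ.trans (abs_eq_uhpDist_of_cosh hu hv ?_)⟩
    rw [Real.cosh_eq, neg_sub, Real.exp_sub, Real.exp_sub, e0, e1, hre]
    field_simp
    ring
  · have hne : v.re - u.re ≠ 0 := sub_ne_zero.2 (Ne.symm hre)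
    -- the centre of the half-circle through `u` and `v`
    obtain ⟨x, hx⟩ : ∃ x : ℝ, (u.re - x) ^ 2 + u.im ^ 2 = (v.re - x) ^ 2 + v.im ^ 2 := by
      refine ⟨(v.re ^ 2 + v.im ^ 2 - u.re ^ 2 - u.im ^ 2) / (2 * (v.re - u.re)), ?_⟩
      field_simp
      ring
    set r := √((u.re - x) ^ 2 + u.im ^ 2) with hr
    have hr0 : 0 < r := Real.sqrt_pos.2 (by positivity)
    have hru : r ^ 2 = (u.re - x) ^ 2 + u.im ^ 2 := Real.sq_sqrt (by positivity)
    have hrv : r ^ 2 = (v.re - x) ^ 2 + v.im ^ 2 := hru.trans hx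
    have key : ∀ w : ℂ, 0 < w.im → r ^ 2 = (w.re - x) ^ 2 + w.im ^ 2 →
        Real.cosh (Real.arsinh ((w.re - x) / w.im)) = r / w.im := by
      intro w hw h
      rw [Real.cosh_arsinh, show 1 + ((w.re - x) / w.im) ^ 2 = (r / w.im) ^ 2 by
        rw [div_pow r, h]; field_simp; ring, Real.sqrt_sq (by positivity)]
    set a := Real.arsinh ((u.re - x) / u.im) with ha
    set b := Real.arsinh ((v.re - x) / v.im) with hb
    have ca : Real.cosh a = r / u.im := key u hu hru
    have cb : Real.cosh b = r / v.im := key v hv hrv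
    have sa : Real.sinh a = (u.re - x) / u.im := Real.sinh_arsinh _
    have sb : Real.sinh b = (v.re - x) / v.im := Real.sinh_arsinh _
    have hs : ∀ t : ℝ, HasDerivAt (fun t : ℝ => a + t * (b - a)) (b - a) t := fun t => by
      simpa using ((hasDerivAt_id t).mul_const (b - a)).const_add a
    have hc0 : ∀ s : ℝ, Real.cosh s ≠ 0 := fun s => (Real.cosh_pos s).ne'
    obtain ⟨γ, hγ, hℓ⟩ := exists_isPath_of_constant_speed
      (X := fun t => x + r * (Real.sinh (a + t * (b - a)) / Real.cosh (a + t * (b - a))))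
      (Y := fun t => r / Real.cosh (a + t * (b - a)))
      (X' := fun t => r * (b - a) / Real.cosh (a + t * (b - a)) ^ 2)
      (Y' := fun t => -(r * (b - a) * Real.sinh (a + t * (b - a))) /
        Real.cosh (a + t * (b - a)) ^ 2)
      (ℓ := b - a)
      (fun t => by
        refine ((((hs t).sinh.div (hs t).cosh (hc0 _)).const_mul r).const_add x).congr_deriv ?_
        have h1 := Real.cosh_sq (a + t * (b - a))
        have h2 := hc0 (a + t * (b - a))
        generalize a + t * (b - a) = s at h1 h2 ⊢
        field_simp
        linear_combination (b - a) * h1)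
      (fun t => by
        refine (((hasDerivAt_const t r).div (hs t).cosh (hc0 _))).congr_deriv ?_
        ring)
      (Continuous.div (by fun_prop) (by fun_prop) fun t => pow_ne_zero _ (hc0 _))
      (Continuous.div (by fun_prop) (by fun_prop) fun t => pow_ne_zero _ (hc0 _))
      (fun t => div_pos hr0 (Real.cosh_pos _))
      (fun t => by
        have h1 := Real.cosh_sq (a + t * (b - a))
        have h2 := hc0 (a + t * (b - a))
        generalize a + t * (b - a) = s at h1 h2 ⊢
        field_simp
        linear_combination -(b - a) ^ 2 * h1)
    have e : ∀ w : ℂ, 0 < w.im → x + r * ((w.re - x) / w.im / (r / w.im)) = w.re ∧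
        r / (r / w.im) = w.im := by
      intro w hw
      constructor <;> field_simp
      ring
    have hab : a + (b - a) = b := by ring
    simp only [zero_mul, add_zero, one_mul, hab, ca, cb, sa, sb] at hγ
    rw [(e u hu).1, (e u hu).2, (e v hv).1, (e v hv).2, Complex.re_add_im,
      Complex.re_add_im] at hγ
    refine ⟨γ, hγ, hℓ.trans (abs_eq_uhpDist_of_cosh hu hv ?_)⟩
    rw [Real.cosh_sub, ca, cb, sa, sb]
    field_simp
    linear_combination hru + hrv

lemma hypDist_exp_le_uhpDist {u v : ℂ} (hu : 0 < u.im) (hv : 0 < v.im) :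
    hypDist (Complex.exp (Complex.I * u)) (Complex.exp (Complex.I * v)) ≤ uhpDist u v := by
  obtain ⟨γ, hγ, hℓ⟩ := exists_isPath_hypLength_eq hu hv
  exact hℓ ▸ hypDist_le_hypLength hγ

lemma exists_isPath {z w : ℂ} (hz : z ∈ puncturedDisc) (hw : w ∈ puncturedDisc) :
    ∃ γ, IsPath γ z w := by
  obtain ⟨u, hu, rfl⟩ := exists_exp_I_mul_eq hz
  obtain ⟨v, hv, rfl⟩ := exists_exp_I_mul_eq hw
  obtain ⟨γ, hγ, -⟩ := exists_isPath_hypLength_eq hu hv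
  exact ⟨γ, hγ⟩

/-! ### Holomorphic self-maps of the punctured disc -/

lemma isOpen_puncturedDisc : IsOpen puncturedDisc := isOpen_ball.sdiff isClosed_singleton

lemma exists_holomorphic_log {G : ℂ → ℂ} (hG : DifferentiableOn ℂ G (ball 0 1))
    (h0 : ∀ x ∈ ball (0 : ℂ) 1, G x ≠ 0) :
    ∃ L : ℂ → ℂ, DifferentiableOn ℂ L (ball 0 1) ∧
      ∀ x ∈ ball (0 : ℂ) 1, Complex.exp (L x) = G x := by
  have hm : (0 : ℂ) ∈ ball (0 : ℂ) 1 := mem_ball_self one_pos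
  obtain ⟨L, hL0, hL⟩ := (((hG.deriv isOpen_ball).div hG h0).isExactOn_ball).with_val_at 0
    (Complex.log (G 0))
  refine ⟨L, fun x hx => (hL x hx).differentiableAt.differentiableWithinAt, fun x hx => ?_⟩
  have hd : ∀ x ∈ ball (0 : ℂ) 1, HasDerivAt (fun x => G x * Complex.exp (-L x)) 0 x := by
    intro x hx
    have hGx := (hG.differentiableAt (isOpen_ball.mem_nhds hx)).hasDerivAt
    refine (hGx.mul (hL x hx).neg.cexp).congr_deriv ?_
    have := h0 x hx
    simp only [Pi.div_apply, Pi.neg_apply]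
    field_simp
    ring
  have hc := isOpen_ball.is_const_of_deriv_eq_zero (convex_ball (0 : ℂ) 1).isPreconnected
    (fun x hx => (hd x hx).differentiableAt.differentiableWithinAt)
    (fun x hx => (hd x hx).deriv) hx hm
  simp only [hL0, Complex.exp_neg, Complex.exp_log (h0 0 hm), mul_inv_cancel₀ (h0 0 hm)] at hc
  rw [← div_eq_mul_inv, div_eq_one_iff_eq (Complex.exp_ne_zero _)] at hc
  exact hc.symm

lemma exists_holomorphic_log_I_mul {G : ℂ → ℂ} (hG : DifferentiableOn ℂ G (ball 0 1))
    (h0 : ∀ x ∈ ball (0 : ℂ) 1, G x ≠ 0) :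
    ∃ Γ : ℂ → ℂ, DifferentiableOn ℂ Γ (ball 0 1) ∧
      ∀ x ∈ ball (0 : ℂ) 1, Complex.exp (Complex.I * Γ x) = G x := by
  obtain ⟨L, hL, hLe⟩ := exists_holomorphic_log hG h0
  refine ⟨fun x => -Complex.I * L x, hL.const_mul _, fun x hx => ?_⟩
  rw [← mul_assoc, mul_neg, Complex.I_mul_I, neg_neg, one_mul, hLe x hx]

/-- The singularity at `0` of a holomorphic self-map of `𝔻*` is removable, and dividing by the
right power of `z` leaves a function without zeros on the whole disc. -/
lemma IsHolomorphicSelfMap.exists_eq_pow_mul {f : ℂ → ℂ} (hf : IsHolomorphicSelfMap f) :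
    ∃ (m : ℕ) (G : ℂ → ℂ), DifferentiableOn ℂ G (ball 0 1) ∧ (∀ x ∈ ball (0 : ℂ) 1, G x ≠ 0) ∧
      ∀ z ∈ puncturedDisc, f z = z ^ m * G z := by
  have hm : ball (0 : ℂ) 1 ∈ 𝓝 (0 : ℂ) := ball_mem_nhds _ one_pos
  set F := Function.update f 0 (limUnder (𝓝[≠] 0) f) with hFdef
  have hF : DifferentiableOn ℂ F (ball 0 1) := by
    refine Complex.differentiableOn_update_limUnder_of_bddAbove hm hf.differentiableOn ⟨1, ?_⟩
    rintro _ ⟨x, hx, rfl⟩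
    exact (mem_ball_zero_iff.1 (hf.mapsTo hx).1).le
  have hFf : ∀ z ∈ puncturedDisc, F z = f z := fun z hz => Function.update_of_ne hz.2 _ _
  have hpun : puncturedDisc ∈ 𝓝[≠] (0 : ℂ) := sdiff_mem_nhdsWithin_compl hm _
  have hnz : ¬ ∀ᶠ z in 𝓝 (0 : ℂ), F z = 0 := by
    intro h
    have h1 : ∀ᶠ z in 𝓝[≠] (0 : ℂ), F z = 0 := h.filter_mono nhdsWithin_le_nhds
    obtain ⟨z, hz, hzp⟩ := (h1.and hpun).exists
    exact (hf.mapsTo hzp).2 ((hFf z hzp).symm.trans hz)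
  obtain ⟨m, g, hg, hg0, hFg⟩ :=
    ((hF.analyticAt hm).exists_eventuallyEq_pow_smul_nonzero_iff).2 hnz
  set G := Function.update (fun z => f z / z ^ m) 0 (g 0) with hGdef
  have hG : ∀ z ∈ puncturedDisc, G z = f z / z ^ m := fun z hz => Function.update_of_ne hz.2 _ _
  have hG0 : G 0 = g 0 := Function.update_self _ _ _
  have hGg : G =ᶠ[𝓝 0] g := by
    filter_upwards [hFg, hm] with z hz hzb
    by_cases h : z = 0
    · rw [h, hG0]
    · have hzp : z ∈ puncturedDisc := ⟨hzb, h⟩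
      rw [sub_zero, smul_eq_mul, hFf z hzp] at hz
      rw [hG z hzp, hz, mul_div_cancel_left₀ _ (pow_ne_zero m h)]
  refine ⟨m, G, ?_, ?_, ?_⟩
  · refine (Complex.differentiableOn_compl_singleton_and_continuousAt_iff hm).1
      ⟨?_, hg.continuousAt.congr hGg.symm⟩
    exact (hf.differentiableOn.div (differentiableOn_id.pow m)
      fun z hz => pow_ne_zero m hz.2).congr hG
  · intro x hx
    by_cases h : x = 0
    · rwa [h, hG0]
    · rw [hG x ⟨hx, h⟩]
      exact div_ne_zero (hf.mapsTo ⟨hx, h⟩).2 (pow_ne_zero m h)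
  · intro z hz
    rw [hG z hz, mul_div_cancel₀ _ (pow_ne_zero m hz.2)]

lemma norm_le_one_of_norm_pow_mul_le {G : ℂ → ℂ} {m : ℕ} (hG : DifferentiableOn ℂ G (ball 0 1))
    (h : ∀ z ∈ puncturedDisc, ‖z ^ m * G z‖ ≤ 1) {x : ℂ} (hx : x ∈ ball (0 : ℂ) 1) : ‖G x‖ ≤ 1 := by
  have hx1 := mem_ball_zero_iff.1 hx
  have key : ∀ r ∈ Ioo ‖x‖ 1, ‖G x‖ ≤ (r ^ m)⁻¹ := by
    intro r hr
    have hr0 : 0 < r := (norm_nonneg x).trans_lt hr.1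
    refine Complex.norm_le_of_forall_mem_frontier_norm_le (U := ball 0 r) isBounded_ball
      ((hG.mono (closedBall_subset_ball hr.2)).diffContOnCl_ball Subset.rfl) ?_
      (subset_closure (mem_ball_zero_iff.2 hr.1))
    intro z hz
    rw [frontier_ball _ hr0.ne', mem_sphere_zero_iff_norm] at hz
    have hzp : z ∈ puncturedDisc := by
      refine ⟨mem_ball_zero_iff.2 (hz ▸ hr.2), fun h0 => ?_⟩
      rw [mem_singleton_iff.1 h0, norm_zero] at hz
      exact hr0.ne hz
    have := h z hzp
    rw [norm_mul, norm_pow, hz] at this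
    rwa [← one_div, le_div_iff₀' (by positivity)]
  have hlim : Tendsto (fun r : ℝ => (r ^ m)⁻¹) (𝓝[<] 1) (𝓝 1) := by
    have : ContinuousAt (fun r : ℝ => (r ^ m)⁻¹) 1 :=
      (continuous_pow m).continuousAt.inv₀ (by simp)
    simpa using this.tendsto.mono_left nhdsWithin_le_nhds
  exact ge_of_tendsto hlim (by filter_upwards [Ioo_mem_nhdsLT hx1] with r hr using key r hr)

lemma degree_eq_of_eq_pow_mul_exp {f Γ : ℂ → ℂ} {m : ℕ} (hΓ : DifferentiableOn ℂ Γ (ball 0 1))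
    (hf : ∀ z ∈ puncturedDisc, f z = z ^ m * Complex.exp (Complex.I * Γ z)) : degree f = m := by
  have hsub : sphere (0 : ℂ) (1 / 2) ⊆ puncturedDisc := by
    intro z hz
    rw [mem_sphere_zero_iff_norm] at hz
    refine ⟨mem_ball_zero_iff.2 (by rw [hz]; norm_num), fun h0 => ?_⟩
    rw [mem_singleton_iff.1 h0, norm_zero] at hz
    norm_num at hz
  have hΓd : ∀ z ∈ puncturedDisc, HasDerivAt Γ (deriv Γ z) z := fun z hz =>
    (hΓ.differentiableAt (isOpen_ball.mem_nhds hz.1)).hasDerivAt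
  have hlog : ∀ z ∈ puncturedDisc,
      deriv f z / f z = m * (z - 0)⁻¹ + Complex.I * deriv Γ z := by
    intro z hz
    have h1 : HasDerivAt (fun z : ℂ => z ^ m * Complex.exp (Complex.I * Γ z)) _ z :=
      (hasDerivAt_pow m z).mul (((hΓd z hz).const_mul Complex.I).cexp)
    have h2 : f =ᶠ[𝓝 z] fun z => z ^ m * Complex.exp (Complex.I * Γ z) := by
      filter_upwards [isOpen_puncturedDisc.mem_nhds hz] with w hw using hf w hw
    have hz0 : z ≠ 0 := hz.2
    have he := Complex.exp_ne_zero (Complex.I * Γ z)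
    rw [(h1.congr_of_eventuallyEq h2).deriv, hf z hz, sub_zero]
    rcases m with _ | m
    · field_simp
      simp
    · rw [Nat.add_sub_cancel]
      field_simp
      ring
  have hI : ∮ z in C(0, 1 / 2), deriv f z / f z = m * (2 * Real.pi * Complex.I) := by
    rw [circleIntegral.integral_congr (by norm_num) fun z hz => hlog z (hsub hz),
      circleIntegral.integral_add, circleIntegral.integral_const_mul,
      circleIntegral.integral_sub_center_inv _ (by norm_num),
      circleIntegral.integral_eq_zero_of_hasDerivWithinAt (by norm_num)
        (fun z hz => ((hΓd z (hsub hz)).const_mul Complex.I).hasDerivWithinAt), add_zero]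
    · refine ContinuousOn.circleIntegrable (by norm_num)
        (continuousOn_const.mul ((continuousOn_id.sub continuousOn_const).inv₀ fun z hz => ?_))
      simpa using (hsub hz).2
    · refine ContinuousOn.circleIntegrable (by norm_num) (continuousOn_const.mul ?_)
      exact ((hΓ.deriv isOpen_ball).continuousOn).mono fun z hz => (hsub hz).1
  rw [degree, hI, mul_comm (m : ℂ), inv_mul_cancel_left₀ Complex.two_pi_I_ne_zero]

/-- The canonical form of a holomorphic self-map of `𝔻*`: on the universal cover it is
`u ↦ m u + Γ (exp (i u))`, where `m` is the degree and `Γ` is holomorphic on the full disc. -/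
lemma IsHolomorphicSelfMap.exists_eq_pow_mul_exp {f : ℂ → ℂ} (hf : IsHolomorphicSelfMap f) :
    ∃ (m : ℕ) (Γ : ℂ → ℂ), DifferentiableOn ℂ Γ (ball 0 1) ∧
      (∀ x ∈ ball (0 : ℂ) 1, 0 ≤ (Γ x).im) ∧
      (∀ z ∈ puncturedDisc, f z = z ^ m * Complex.exp (Complex.I * Γ z)) ∧ degree f = m := by
  obtain ⟨m, G, hG, hG0, hfG⟩ := hf.exists_eq_pow_mul
  obtain ⟨Γ, hΓ, hΓe⟩ := exists_holomorphic_log_I_mul hG hG0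
  have hfΓ : ∀ z ∈ puncturedDisc, f z = z ^ m * Complex.exp (Complex.I * Γ z) := fun z hz => by
    rw [hfG z hz, hΓe z hz.1]
  refine ⟨m, Γ, hΓ, fun x hx => ?_, hfΓ, degree_eq_of_eq_pow_mul_exp hΓ hfΓ⟩
  have h := norm_le_one_of_norm_pow_mul_le (m := m) hG (fun z hz => by
    rw [← hfG z hz]; exact (mem_ball_zero_iff.1 (hf.mapsTo hz).1).le) hx
  rw [← hΓe x hx, norm_exp_I_mul, Real.exp_le_one_iff] at h
  linarith

/-- A consequence of the open mapping theorem. -/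
lemma im_pos_or_eq_real_const {Γ : ℂ → ℂ} (hΓ : DifferentiableOn ℂ Γ (ball 0 1))
    (hΓ0 : ∀ x ∈ ball (0 : ℂ) 1, 0 ≤ (Γ x).im) :
    (∀ x ∈ ball (0 : ℂ) 1, 0 < (Γ x).im) ∨ ∃ θ : ℝ, ∀ x ∈ ball (0 : ℂ) 1, Γ x = θ := by
  have hm : (0 : ℂ) ∈ ball (0 : ℂ) 1 := mem_ball_self one_pos
  rcases (hΓ.analyticOnNhd isOpen_ball).is_constant_or_isOpen
    (convex_ball (0 : ℂ) 1).isPreconnected with ⟨w, hw⟩ | h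
  · have h0 := hΓ0 0 hm
    rw [hw 0 hm] at h0
    rcases h0.lt_or_eq with h0 | h0
    · exact Or.inl fun x hx => by rwa [hw x hx]
    · exact Or.inr ⟨w.re, fun x hx => by rw [hw x hx]; exact Complex.ext (by simp) (by simp [← h0])⟩
  · left
    have h1 : Γ '' ball 0 1 ⊆ interior {z : ℂ | 0 ≤ z.im} :=
      interior_maximal (by rintro _ ⟨x, hx, rfl⟩; exact hΓ0 x hx) (h _ Subset.rfl isOpen_ball)
    rw [Complex.interior_setOfPred_le_im] at h1
    exact fun x hx => h1 ⟨x, hx, rfl⟩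

/-! ### Self-coverings are rotated powers -/

/-- A continuous lift of a holomorphic map `P` without critical points through a holomorphic map
`h` is holomorphic. At critical points of `h` this is a removable singularity: `q` is injective near
every point because `P` is, so such points are isolated. -/
lemma differentiableOn_of_comp_eq {h P q : ℂ → ℂ} {U V : Set ℂ} (hU : IsOpen U) (hV : IsOpen V)
    (hh : DifferentiableOn ℂ h V) (hP : DifferentiableOn ℂ P U) (hP' : ∀ x ∈ U, deriv P x ≠ 0)
    (hq : ContinuousOn q U) (hqV : MapsTo q U V) (hhq : ∀ x ∈ U, h (q x) = P x) :
    DifferentiableOn ℂ q U := by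
  have hPd : ∀ x ∈ U, HasDerivAt P (deriv P x) x := fun x hx =>
    (hP.differentiableAt (hU.mem_nhds hx)).hasDerivAt
  have hqc : ∀ x ∈ U, ContinuousAt q x := fun x hx => hq.continuousAt (hU.mem_nhds hx)
  have hha : ∀ w ∈ V, AnalyticAt ℂ h w := fun w hw => hh.analyticAt (hV.mem_nhds hw)
  have hreg : ∀ x ∈ U, deriv h (q x) ≠ 0 → DifferentiableAt ℂ q x := by
    intro x hx hx'
    have hs := (hha _ (hqV hx)).hasStrictDerivAt
    have h1 := hs.to_localInverse hx'
    rw [hhq x hx] at h1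
    refine (h1.hasDerivAt.comp x (hPd x hx)).differentiableAt.congr_of_eventuallyEq ?_
    filter_upwards [(hqc x hx).eventually (hs.eventually_left_inverse hx'), hU.mem_nhds hx]
      with y hy hyU
    rw [Function.comp_apply, ← hhq y hyU, hy]
  intro x hx
  refine DifferentiableAt.differentiableWithinAt ?_
  have hne : ∀ᶠ y in 𝓝[≠] x, q y ≠ q x := by
    filter_upwards [(hPd x hx).eventually_ne (hP' x hx) (c := P x),
      nhdsWithin_le_nhds (hU.mem_nhds hx)] with y hy hyU he
    exact hy (by rw [← hhq y hyU, ← hhq x hx, he])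
  rcases (hha _ (hqV hx)).deriv.eventually_eq_zero_or_eventually_ne_zero with h0 | h0
  · exfalso
    obtain ⟨ε, hε, hb⟩ := Metric.eventually_nhds_iff_ball.1 (h0.and (hV.mem_nhds (hqV hx)))
    have hconst : ∀ w ∈ ball (q x) ε, h w = h (q x) := fun w hw =>
      isOpen_ball.is_const_of_deriv_eq_zero (convex_ball (q x) ε).isPreconnected
        (hh.mono fun y hy => (hb y hy).2) (fun y hy => (hb y hy).1) hw (mem_ball_self hε)
    have hPc : P =ᶠ[𝓝 x] fun _ => P x := by
      filter_upwards [(hqc x hx).eventually (ball_mem_nhds _ hε), hU.mem_nhds hx] with y hy hyU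
      rw [← hhq y hyU, ← hhq x hx, hconst _ hy]
    exact hP' x hx (by rw [hPc.deriv_eq]; simp)
  · refine (Complex.analyticAt_of_differentiable_on_punctured_nhds_of_continuousAt ?_
      (hqc x hx)).differentiableAt
    have ht : Tendsto q (𝓝[≠] x) (𝓝[≠] (q x)) :=
      tendsto_nhdsWithin_iff.2 ⟨(hqc x hx).tendsto.mono_left nhdsWithin_le_nhds, hne⟩
    filter_upwards [ht.eventually h0, nhdsWithin_le_nhds (hU.mem_nhds hx)] with y hy hyU
    exact hreg y hyU hy

lemma IsHolomorphicSelfCovering.exists_lift {h P : ℂ → ℂ} (hh : IsHolomorphicSelfCovering h)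
    (hP : DifferentiableOn ℂ P (ball 0 1)) (hPm : MapsTo P (ball 0 1) puncturedDisc)
    (hP' : ∀ x ∈ ball (0 : ℂ) 1, deriv P x ≠ 0) {w : ℂ} (hw : w ∈ puncturedDisc)
    (hwP : h w = P 0) :
    ∃ q : ℂ → ℂ, DifferentiableOn ℂ q (ball 0 1) ∧ MapsTo q (ball 0 1) puncturedDisc ∧
      q 0 = w ∧ ∀ x ∈ ball (0 : ℂ) 1, h (q x) = P x := by
  classical
  have hm : (0 : ℂ) ∈ ball (0 : ℂ) 1 := mem_ball_self one_pos
  have : ContractibleSpace (ball (0 : ℂ) 1) := (convex_ball (0 : ℂ) 1).contractibleSpace ⟨0, hm⟩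
  have : LocallyPathConnectedSpace (ball (0 : ℂ) 1) := isOpen_ball.locallyPathConnectedSpace
  obtain ⟨Q, ⟨hQ0, hQ⟩, -⟩ := hh.isCoveringMap.existsUnique_continuousMap_lifts
    (⟨hPm.restrict P _ _, hP.continuousOn.mapsToRestrict hPm⟩ :
      C(ball (0 : ℂ) 1, puncturedDisc)) ⟨0, hm⟩ ⟨w, hw⟩ (Subtype.ext hwP)
  set q : ℂ → ℂ := fun x => if hx : x ∈ ball (0 : ℂ) 1 then (Q ⟨x, hx⟩ : ℂ) else 0 with hq
  have hqQ : ∀ x (hx : x ∈ ball (0 : ℂ) 1), q x = Q ⟨x, hx⟩ := fun x hx => dif_pos hx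
  have hqm : MapsTo q (ball 0 1) puncturedDisc := fun x hx => by
    rw [hqQ x hx]; exact (Q ⟨x, hx⟩).2
  have hhq : ∀ x ∈ ball (0 : ℂ) 1, h (q x) = P x := fun x hx => by
    rw [hqQ x hx]
    exact congrArg Subtype.val (congrFun hQ ⟨x, hx⟩)
  have hqc : ContinuousOn q (ball 0 1) := by
    rw [continuousOn_iff_continuous_domRestrict]
    exact (continuous_subtype_val.comp Q.continuous).congr fun x => (hqQ x x.2).symm
  refine ⟨q, differentiableOn_of_comp_eq isOpen_ball isOpen_puncturedDisc hh.differentiableOn hP hP'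
    hqc hqm hhq, hqm, ?_, hhq⟩
  rw [hqQ 0 hm, hQ0]

/-- A holomorphic self-covering of `𝔻*` is `z ↦ exp (i θ) z ^ m` with `θ` real. Otherwise
`H u = m u + Γ (exp (i u))` would strictly contract the hyperbolic metric at points `u` of large
imaginary part, because `Γ` is holomorphic on the full disc; but `H` has a holomorphic right inverse
obtained by lifting the universal cover through `h`, which does not expand the metric. -/
lemma IsHolomorphicSelfCovering.eq_real_const {h Γ : ℂ → ℂ} {m : ℕ}
    (hh : IsHolomorphicSelfCovering h) (hΓ : DifferentiableOn ℂ Γ (ball 0 1))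
    (hΓ0 : ∀ x ∈ ball (0 : ℂ) 1, 0 ≤ (Γ x).im)
    (hhΓ : ∀ z ∈ puncturedDisc, h z = z ^ m * Complex.exp (Complex.I * Γ z)) :
    ∃ θ : ℝ, ∀ x ∈ ball (0 : ℂ) 1, Γ x = θ := by
  refine (im_pos_or_eq_real_const hΓ hΓ0).resolve_left fun hpos => ?_
  have hm : (0 : ℂ) ∈ ball (0 : ℂ) 1 := mem_ball_self one_pos
  -- the base point `w = exp (-2)` lies below `2 i`
  set w : ℂ := Complex.exp (Complex.I * (2 * Complex.I)) with hwdef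
  have hw : w ∈ puncturedDisc := exp_I_mul_mem_puncturedDisc (by simp)
  have hwn : ‖w‖ = Real.exp (-2) := by rw [hwdef, norm_exp_I_mul]; simp
  set ζ : ℂ := m * (2 * Complex.I) + Γ w with hζdef
  have hζim : ζ.im = 2 * m + (Γ w).im := by
    simp [hζdef, mul_comm]
  have hΓw := hpos w hw.1
  have hζ : 0 < ζ.im := by rw [hζim]; positivity
  set φ := discToUpperHalfPlane ζ with hφdef
  have hφd : ∀ x ∈ ball (0 : ℂ) 1, HasDerivAt φ _ x := fun x hx =>
    hasDerivAt_discToUpperHalfPlane ζ hx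
  have hφpos : ∀ x ∈ ball (0 : ℂ) 1, 0 < (φ x).im := fun x hx => discToUpperHalfPlane_im_pos hζ hx
  have hPd : ∀ x ∈ ball (0 : ℂ) 1, HasDerivAt (fun x => Complex.exp (Complex.I * φ x)) _ x :=
    fun x hx => ((hφd x hx).const_mul Complex.I).cexp
  obtain ⟨q, hq, hqm, hq0, hhq⟩ := hh.exists_lift (P := fun x => Complex.exp (Complex.I * φ x))
    (fun x hx => (hPd x hx).differentiableAt.differentiableWithinAt)
    (fun x hx => exp_I_mul_mem_puncturedDisc (hφpos x hx))
    (fun x hx => by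
      rw [(hPd x hx).deriv]
      exact mul_ne_zero (Complex.exp_ne_zero _) (mul_ne_zero Complex.I_ne_zero
        (div_ne_zero (sub_conj_ne_zero hζ hζ) (pow_ne_zero 2 (one_sub_ne_zero_of_mem_ball hx)))))
    hw (by
      simp only [hφdef, discToUpperHalfPlane_zero]
      rw [hhΓ w hw, hζdef, mul_add, Complex.exp_add, hwdef, ← Complex.exp_nat_mul]
      congr 2
      ring)
  obtain ⟨Q, hQ, hQe⟩ := exists_holomorphic_log_I_mul hq fun x hx => (hqm hx).2
  have hQpos : ∀ x ∈ ball (0 : ℂ) 1, 0 < (Q x).im := fun x hx =>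
    im_pos_of_exp_I_mul_mem (by rw [hQe x hx]; exact hqm hx)
  have hQ0 : (Q 0).im = 2 := by
    have h1 : Real.exp (-(Q 0).im) = Real.exp (-2) := by
      rw [← norm_exp_I_mul, hQe 0 hm, hq0, hwn]
    have := Real.exp_injective h1
    linarith
  have hQd : HasDerivAt Q (deriv Q 0) 0 :=
    (hQ.differentiableAt (isOpen_ball.mem_nhds hm)).hasDerivAt
  have hqd : HasDerivAt q (w * (Complex.I * deriv Q 0)) 0 := by
    have h1 := (hQd.const_mul Complex.I).cexp
    rw [hQe 0 hm, hq0] at h1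
    refine h1.congr_of_eventuallyEq ?_
    filter_upwards [isOpen_ball.mem_nhds hm] with x hx using (hQe x hx).symm
  have hΓd : HasDerivAt Γ (deriv Γ w) (q 0) := by
    rw [hq0]; exact (hΓ.differentiableAt (isOpen_ball.mem_nhds hw.1)).hasDerivAt
  -- `m Q + Γ ∘ q` and `φ` both lift `h ∘ q`, so they have the same derivative
  have hφ0 := hφd 0 hm
  rw [sub_zero, one_pow, div_one] at hφ0
  have hX := ((hQd.const_mul (m : ℂ)).add (hΓd.comp 0 hqd)).sub hφ0
  have hXe : (fun x => Complex.exp (Complex.I * (((fun x => (m : ℂ) * Q x) + Γ ∘ q - φ) x)))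
      =ᶠ[𝓝 0] fun _ => 1 := by
    filter_upwards [isOpen_ball.mem_nhds hm] with x hx
    have h1 := hhq x hx
    rw [hhΓ _ (hqm hx), ← hQe x hx, ← Complex.exp_nat_mul, ← Complex.exp_add, hQe x hx] at h1
    simp only [Pi.sub_apply, Pi.add_apply, Function.comp_apply]
    rw [mul_sub, Complex.exp_sub, ← h1, div_eq_one_iff_eq (Complex.exp_ne_zero _)]
    congr 1
    ring
  have hX' := (hX.const_mul Complex.I).cexp.deriv
  rw [hXe.deriv_eq, deriv_const] at hX'
  have hkey : deriv Q 0 * (m + deriv Γ w * w * Complex.I) = ζ - (starRingEnd ℂ) ζ := by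
    have h1 := (mul_eq_zero.1 hX'.symm).resolve_left (Complex.exp_ne_zero _)
    have h2 := (mul_eq_zero.1 h1).resolve_left Complex.I_ne_zero
    linear_combination h2
  have hQ1 : ‖deriv Q 0‖ ≤ 4 := by
    have := norm_deriv_le_of_mapsTo_upperHalfPlane one_pos hQ hQpos
    rw [hQ0] at this
    linarith
  set e := Real.exp (-2) with hedef
  have he0 : 0 < e := Real.exp_pos _
  have he5 : 5 * e < 1 := by
    have h1 : (5 : ℝ) < Real.exp 2 := by
      have h2 := Real.exp_one_gt_d9
      have h3 : Real.exp 2 = Real.exp 1 * Real.exp 1 := by rw [← Real.exp_add]; norm_num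
      rw [h3]
      nlinarith
    rw [hedef, Real.exp_neg, ← div_eq_mul_inv, div_lt_one (Real.exp_pos _)]
    exact h1
  have hsub : ball w (1 - e) ⊆ ball (0 : ℂ) 1 :=
    ball_subset_ball' (by rw [dist_zero_right, hwn]; linarith)
  have hΓ1 : ‖deriv Γ w‖ ≤ 2 * (Γ w).im / (1 - e) :=
    norm_deriv_le_of_mapsTo_upperHalfPlane (by linarith) (hΓ.mono hsub)
      fun x hx => hpos x (hsub hx)
  have hn : ‖ζ - (starRingEnd ℂ) ζ‖ = 2 * ζ.im := by
    rw [Complex.sub_conj, norm_mul, Complex.norm_I, Complex.norm_real, Real.norm_of_nonneg]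
    · ring
    · linarith
  have h1 : 2 * (2 * m + (Γ w).im) ≤ 4 * (m + 2 * (Γ w).im / (1 - e) * e) := by
    rw [← hζim, ← hn, ← hkey, norm_mul]
    gcongr
    refine (norm_add_le _ _).trans ?_
    rw [norm_mul, norm_mul, Complex.norm_I, mul_one, hwn, Complex.norm_natCast]
    gcongr
  have h2 : 2 * (Γ w).im / (1 - e) * e < (Γ w).im / 2 := by
    rw [div_mul_eq_mul_div, div_lt_iff₀ (by linarith)]
    nlinarith
  linarith

/-! ### Comparison of displacements -/

lemma mul_sinh_le_sinh_mul {M y : ℝ} (hM : 1 ≤ M) (hy : 0 ≤ y) :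
    M * Real.sinh y ≤ Real.sinh (M * y) := by
  have hd : ∀ x, HasDerivAt (fun x => Real.sinh (M * x) - M * Real.sinh x)
      (Real.cosh (M * x) * (M * 1) - M * Real.cosh x) x := fun x =>
    (((hasDerivAt_id x).const_mul M).sinh).sub ((Real.hasDerivAt_sinh x).const_mul M)
  have hmono : MonotoneOn (fun x => Real.sinh (M * x) - M * Real.sinh x) (Ici 0) := by
    refine monotoneOn_of_deriv_nonneg (convex_Ici 0) (by fun_prop)
      (fun x _ => (hd x).differentiableAt.differentiableWithinAt) fun x hx => ?_
    rw [interior_Ici] at hx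
    have hx0 : 0 < x := hx
    have h1 : Real.cosh x ≤ Real.cosh (M * x) := by
      rw [Real.cosh_le_cosh, abs_of_pos hx0, abs_of_pos (by positivity)]
      exact le_mul_of_one_le_left hx0.le hM
    rw [(hd x).deriv, mul_one, mul_comm, ← mul_sub]
    exact mul_nonneg (by linarith) (by linarith)
  have := hmono (self_mem_Ici) hy hy
  simp only [mul_zero, Real.sinh_zero, sub_zero] at this
  linarith

/-- If the translation vector at `u` is comparable with the one at `v`, up to the factor
`exp (uhpDist u v)`, then so are the corresponding hyperbolic displacements. -/
lemma uhpDist_displacement_le {k : ℝ} (hk : 0 < k) {u v Z W : ℂ} (hu : 0 < u.im) (hv : 0 < v.im)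
    (hZ : 0 ≤ Z.im) (hW : 0 ≤ W.im) (hnorm : ‖Z‖ ≤ ‖W‖ * Real.exp (uhpDist u v))
    (him : W.im ≤ Z.im * Real.exp (uhpDist u v)) :
    uhpDist (k * u + Z) (k * u) ≤ Real.exp (uhpDist u v) ^ 2 * uhpDist (k * v + W) (k * v) := by
  have hvu : v.im ≤ u.im * Real.exp (uhpDist u v) := by
    rw [uhpDist_comm]; exact im_le_im_mul_exp_uhpDist hv hu
  set E := Real.exp (uhpDist u v) with hE
  have hE1 : 1 ≤ E := Real.one_le_exp (uhpDist_nonneg _ _)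
  have hE0 : 0 < E := Real.exp_pos _
  have e1 : ∀ x Y : ℂ, Real.sinh (uhpDist (k * x + Y) (k * x) / 2) =
      ‖Y‖ / (2 * √((k * x.im + Y.im) * (k * x.im))) := fun x Y => by
    rw [sinh_half_uhpDist]; simp
  have h1 : √((k * v.im + W.im) * (k * v.im)) ≤ E * √((k * u.im + Z.im) * (k * u.im)) := by
    rw [← Real.sqrt_sq hE0.le, ← Real.sqrt_mul (by positivity)]
    refine Real.sqrt_le_sqrt ?_
    calc (k * v.im + W.im) * (k * v.im)
        ≤ (k * (u.im * E) + Z.im * E) * (k * (u.im * E)) := by gcongr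
      _ = _ := by ring
  have h2 : Real.sinh (uhpDist (k * u + Z) (k * u) / 2) ≤
      E ^ 2 * Real.sinh (uhpDist (k * v + W) (k * v) / 2) := by
    rw [e1, e1, mul_div_assoc', div_le_div_iff₀ (by positivity) (by positivity)]
    calc ‖Z‖ * (2 * √((k * v.im + W.im) * (k * v.im)))
        ≤ (‖W‖ * E) * (2 * (E * √((k * u.im + Z.im) * (k * u.im)))) := by gcongr
      _ = _ := by ring
  have h3 := h2.trans (mul_sinh_le_sinh_mul (one_le_pow₀ hE1 : 1 ≤ E ^ 2)
    (div_nonneg (uhpDist_nonneg _ _) zero_le_two))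
  rw [Real.sinh_le_sinh] at h3
  linarith

/-- A Harnack-type inequality, from the Schwarz–Pick lemma on the universal cover of `𝔻*`. -/
lemma norm_le_and_im_le_of_im_nonneg {Γ : ℂ → ℂ} (hΓ : DifferentiableOn ℂ Γ (ball 0 1))
    (hΓ0 : ∀ x ∈ ball (0 : ℂ) 1, 0 ≤ (Γ x).im) {u v : ℂ} (hu : 0 < u.im) (hv : 0 < v.im) :
    ‖Γ (Complex.exp (Complex.I * u))‖ ≤
        ‖Γ (Complex.exp (Complex.I * v))‖ * Real.exp (uhpDist u v) ∧
      (Γ (Complex.exp (Complex.I * v))).im ≤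
        (Γ (Complex.exp (Complex.I * u))).im * Real.exp (uhpDist u v) := by
  have hmem : ∀ x : ℂ, 0 < x.im → Complex.exp (Complex.I * x) ∈ ball (0 : ℂ) 1 := fun x hx =>
    (exp_I_mul_mem_puncturedDisc hx).1
  have hE1 : 1 ≤ Real.exp (uhpDist u v) := Real.one_le_exp (uhpDist_nonneg _ _)
  rcases im_pos_or_eq_real_const hΓ hΓ0 with hpos | ⟨θ, hθ⟩
  · have hSP := uhpDist_map_le (F := fun x => Γ (Complex.exp (Complex.I * x)))
      (hΓ.comp (by fun_prop) fun x hx => hmem x hx) (fun x hx => hpos _ (hmem x hx)) hu hv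
    have hpu := hpos _ (hmem u hu)
    have hpv := hpos _ (hmem v hv)
    have hexp := Real.exp_le_exp.2 hSP
    refine ⟨(norm_le_norm_mul_exp_uhpDist hpu hpv).trans (by gcongr), ?_⟩
    refine (im_le_im_mul_exp_uhpDist hpv hpu).trans ?_
    rw [uhpDist_comm]
    gcongr
  · rw [hθ _ (hmem u hu), hθ _ (hmem v hv)]
    exact ⟨le_mul_of_one_le_right (norm_nonneg _) hE1, by simp⟩

lemma exists_hypLength_lt {z w : ℂ} (hz : z ∈ puncturedDisc) (hw : w ∈ puncturedDisc) {ε : ℝ}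
    (hε : 0 < ε) : ∃ γ, IsPath γ z w ∧ hypLength γ < hypDist z w + ε := by
  obtain ⟨γ₀, hγ₀⟩ := exists_isPath hz hw
  obtain ⟨_, ⟨γ, hγ, rfl⟩, hlt⟩ := exists_lt_of_csInf_lt
    (s := {ℓ : ℝ | ∃ γ : ℝ → ℂ, IsPath γ z w ∧ ℓ = hypLength γ}) ⟨_, γ₀, hγ₀, rfl⟩
    (lt_add_of_pos_right (hypDist z w) hε)
  exact ⟨γ, hγ, hlt⟩

/-- The comparison along given paths from `z` to `a` and from `f a` to `h a`. -/
lemma hypDist_le_exp_hypLength_mul {f h : ℂ → ℂ} (hf : IsHolomorphicSelfMap f)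
    (hh : IsHolomorphicSelfCovering h) (hdeg : degree f = degree h) (hpos : 0 < degree h)
    {a z : ℂ} {γ σ : ℝ → ℂ} (hz : z ∈ puncturedDisc) (hγ : IsPath γ z a)
    (hσ : IsPath σ (f a) (h a)) :
    hypDist (f z) (h z) ≤ Real.exp (hypLength γ) ^ 2 * hypLength σ := by
  obtain ⟨m, Γ, hΓ, hΓ0, hfΓ, hfm⟩ := hf.exists_eq_pow_mul_exp
  obtain ⟨n, Λ, hΛ, hΛ0, hhΛ, hhn⟩ := hh.toIsHolomorphicSelfMap.exists_eq_pow_mul_exp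
  obtain ⟨θ, hθ⟩ := hh.eq_real_const hΛ hΛ0 hhΛ
  obtain rfl : m = n := by
    rw [hfm, hhn] at hdeg
    exact_mod_cast hdeg
  have hm : (0 : ℝ) < m := by
    rw [hhn] at hpos
    exact_mod_cast hpos
  obtain ⟨u, hu, rfl⟩ := exists_exp_I_mul_eq hz
  obtain ⟨v, hv, rfl, hd⟩ := hγ.exists_lift rfl
  have hmem : ∀ x : ℂ, 0 < x.im → Complex.exp (Complex.I * x) ∈ puncturedDisc := fun x hx =>
    exp_I_mul_mem_puncturedDisc hx
  have hfx : ∀ x : ℂ, 0 < x.im → Complex.exp (Complex.I *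
      ((m : ℝ) * x + Γ (Complex.exp (Complex.I * x)))) = f (Complex.exp (Complex.I * x)) := by
    intro x hx
    rw [hfΓ _ (hmem x hx), ← Complex.exp_nat_mul, ← Complex.exp_add]
    congr 1
    push_cast
    ring
  have hhx : ∀ x : ℂ, 0 < x.im → Complex.exp (Complex.I * ((m : ℝ) * x + θ)) =
      h (Complex.exp (Complex.I * x)) := by
    intro x hx
    rw [hhΛ _ (hmem x hx), hθ _ (hmem x hx).1, ← Complex.exp_nat_mul, ← Complex.exp_add]
    congr 1
    push_cast
    ring
  -- `σ` lifts to a path ending at a translate of `m v + θ` by a multiple `2 π j` of the period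
  obtain ⟨y, hy, hye, hdσ⟩ := hσ.exists_lift (hfx v hv)
  rw [← hhx v hv, Complex.exp_eq_exp_iff_exists_int] at hye
  obtain ⟨j, hj⟩ := hye
  set θ' : ℝ := θ + j * (2 * Real.pi) with hθ'
  have hy' : y = (m : ℝ) * v + θ' := by
    refine mul_left_cancel₀ Complex.I_ne_zero (hj.trans ?_)
    rw [hθ']
    push_cast
    ring
  have hhu : Complex.exp (Complex.I * ((m : ℝ) * u + θ')) = h (Complex.exp (Complex.I * u)) := by
    rw [← hhx u hu, Complex.exp_eq_exp_iff_exists_int]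
    refine ⟨j, ?_⟩
    rw [hθ']
    push_cast
    ring
  -- a real translation of the cover makes `h` correspond to `x ↦ m x`
  have htr : ∀ x G : ℂ, uhpDist ((m : ℝ) * x + G) ((m : ℝ) * x + θ') =
      uhpDist ((m : ℝ) * x + (G - θ')) ((m : ℝ) * x) := by
    intro x G
    rw [uhpDist, uhpDist]
    congr 3
    · congr 1; ring
    · simp
  have hG0 : ∀ x ∈ ball (0 : ℂ) 1, 0 ≤ (Γ x - θ').im := fun x hx => by
    simpa using hΓ0 x hx
  obtain ⟨hnorm, him⟩ := norm_le_and_im_le_of_im_nonneg (hΓ.sub_const (θ' : ℂ)) hG0 hu hv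
  have hdis := uhpDist_displacement_le hm hu hv (hG0 _ (hmem u hu).1) (hG0 _ (hmem v hv).1)
    hnorm him
  rw [← htr, ← htr, ← hy'] at hdis
  have hup : 0 < ((m : ℝ) * u + Γ (Complex.exp (Complex.I * u)) : ℂ).im :=
    im_pos_of_exp_I_mul_mem (by rw [hfx u hu]; exact hf.mapsTo (hmem u hu))
  have hup' : 0 < ((m : ℝ) * u + θ' : ℂ).im :=
    im_pos_of_exp_I_mul_mem (by rw [hhu]; exact hh.mapsTo (hmem u hu))
  calc hypDist (f (Complex.exp (Complex.I * u))) (h (Complex.exp (Complex.I * u)))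
      ≤ _ := by rw [← hfx u hu, ← hhu]; exact hypDist_exp_le_uhpDist hup hup'
    _ ≤ _ := hdis
    _ ≤ _ := by
      have := uhpDist_nonneg ((m : ℝ) * v + Γ (Complex.exp (Complex.I * v))) y
      gcongr

end PuncturedDisc

theorem mainTheorem3 (f h : ℂ → ℂ)
    (hf : PuncturedDisc.IsHolomorphicSelfMap f)
    (hh : PuncturedDisc.IsHolomorphicSelfCovering h)
    (hdeg : PuncturedDisc.degree f = PuncturedDisc.degree h)
    (hpos : 0 < PuncturedDisc.degree h)
    (a z : ℂ) (ha : a ∈ PuncturedDisc.puncturedDisc) (hz : z ∈ PuncturedDisc.puncturedDisc) :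
    PuncturedDisc.hypDist (f z) (h z) ≤
      (8 * PuncturedDisc.density a * Real.exp (PuncturedDisc.hypDist z a)) ^ 3 *
        PuncturedDisc.hypDist (f a) (h a) := by
  -- the factor `8` in `L` absorbs the factor `exp 1` lost by a path that is not of minimal length
  obtain ⟨γ, hγ, hlt⟩ := PuncturedDisc.exists_hypLength_lt hz ha one_pos
  have hd := PuncturedDisc.one_le_density ha
  obtain ⟨σ₀, hσ₀⟩ := PuncturedDisc.exists_isPath (hf.mapsTo ha) (hh.mapsTo ha)
  set L := 8 * PuncturedDisc.density a * Real.exp (PuncturedDisc.hypDist z a) with hL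
  have hexp : Real.exp (PuncturedDisc.hypLength γ) ≤ L := by
    calc Real.exp (PuncturedDisc.hypLength γ) ≤ Real.exp (PuncturedDisc.hypDist z a + 1) :=
          Real.exp_le_exp.2 hlt.le
      _ = Real.exp 1 * Real.exp (PuncturedDisc.hypDist z a) := by rw [add_comm, Real.exp_add]
      _ ≤ L := by
        rw [hL]
        gcongr
        linarith [Real.exp_one_lt_d9]
  have hL1 : 1 ≤ L :=
    (Real.one_le_exp (PuncturedDisc.hypLength_nonneg hγ)).trans hexp
  have hL0 : 0 < L ^ 3 := by positivity
  rw [← div_le_iff₀' hL0]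
  -- it is enough to compare with the length of each path from `f a` to `h a`
  refine le_csInf ⟨_, σ₀, hσ₀, rfl⟩ ?_
  rintro _ ⟨σ, hσ, rfl⟩
  rw [div_le_iff₀' hL0]
  have hσ0 := PuncturedDisc.hypLength_nonneg hσ
  refine (PuncturedDisc.hypDist_le_exp_hypLength_mul hf hh hdeg hpos hz hγ hσ).trans ?_
  calc Real.exp (PuncturedDisc.hypLength γ) ^ 2 * PuncturedDisc.hypLength σ
      ≤ L ^ 2 * PuncturedDisc.hypLength σ := by gcongr
    _ ≤ L ^ 3 * PuncturedDisc.hypLength σ := by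
      gcongr
      norm_num
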